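/- An $(n,m,v)$ Bell scenario has $n$ parties, each with $m$ inputs and $v$ outcomes per input. A box is a family of numbers $p[a\mid x]$, indexed by input tuples $x=(x_1,\dots,x_n)\in\{0,\dots,m-1\}^n$ and outcome tuples $a=(a_1,\dots,a_n)\in\{0,\dots,v-1\}^n$. Let $\mathcal{Q}_2=\mathcal{Q}_2^{(n,m,v)}$ be the set of boxes obtainable from shared qubits, i.e. of the form $$p[a\mid x]=\operatorname{Tr}\Bigl(\rho\,\bigl(A^{(1)}_{a_1|x_1}\otimes\cdots\otimes A^{(n)}_{a_n|x_n}\bigr)\Bigr),$$ where $\rho$ is an arbitrary (possibly mixed, possibly entangled) density operator on $(\mathbb{C}^2)^{\otimes n}$ and, for every party $i$ and input $x_i$, $(A^{(i)}_{a_i|x_i})_{a_i}$ is an arbitrary POVM on $\mathbb{C}^2$ with $v$ outcomes. 1. For all $n\ge 2$, $m\ge 2$ and $v\ge 2$, the set $\mathcal{Q}_2^{(n,m,v)}$ is not convex. In particular, $\mathcal{Q}_2$ is not convex in the $(2,2,2)$ (CHSH) scenario. 2. In the $(2,2,2)$ scenario, describe a box by its biases $\langle A_x\rangle=p[a{=}1|x]-p[a{=}0|x]$,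 $\langle B_y\rangle=p[b{=}1|y]-p[b{=}0|y]$ and $\langle A_xB_y\rangle=p[a{=}b|xy]-p[a{\ne}b|xy]$, so that $p[ab|xy]=\tfrac14\bigl(1+s_a\langle A_x\rangle+s_b\langle B_y\rangle+s_as_b\langle A_xB_y\rangle\bigr)$ with $s_1=1$, $s_0=-1$. Let $P_1,P_3,P_4$ be the boxes with $$\begin{array}{c|cccc|cccc} & \langle A_0\rangle&\langle A_1\rangle&\langle B_0\rangle&\langle B_1\rangle&\langle A_0B_0\rangle&\langle A_1B_0\rangle&\langle A_0B_1\rangle&\langle A_1B_1\rangle\\\hline P_1&1&1&1&1&1&1&1&1\\P_3&1&-1&1&-1&1&-1&-1&1\\P_4&-1&1&-1&1&1&-1&-1&1\end{array}$$ Then $P_1,P_3,P_4\in\mathcal{Q}_2$, and for all $c_1,c_3,c_4\ge 0$ with $c_1+c_3+c_4=1$, $$c_1P_1+c_3P_3+c_4P_4\in\mathcal{Q}_2\iff c_1=0\ \text{ or }\ c_3=0\ \text{ or }\ c_4=0.$$ In particular, no mixture with all three weights nonzero is in $\mathcal{Q}_2$. -/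

import Mathlib

open scoped ComplexOrder

namespace Bell

/-- A box of the `(n, m, v)` Bell scenario: `p x a` is the conditional probability `p[a | x]` of
the outcome tuple `a` given the input tuple `x`, with one input and one outcome per party. -/
abbrev Box (n m v : ℕ) : Type :=
  (Fin n → Fin m) → (Fin n → Fin v) → ℝ

/-- Operators on the local Hilbert space `ℂ^d`. -/
abbrev LocalOp (d : ℕ) : Type := Matrix (Fin d) (Fin d) ℂ

/-- Operators on `(ℂ^d)^{⊗ n}`, as matrices in the product basis, whose elements
`|s 0⟩ ⊗ ⋯ ⊗ |s (n-1)⟩` are indexed by tuples `s : Fin n → Fin d`. -/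
abbrev GlobalOp (n d : ℕ) : Type := Matrix (Fin n → Fin d) (Fin n → Fin d) ℂ

/-- The tensor product `M 0 ⊗ ⋯ ⊗ M (n-1)` of local operators (the `n`-fold Kronecker product). -/
def tensorOp {n d : ℕ} (M : Fin n → LocalOp d) : GlobalOp n d :=
  Matrix.of fun s t => ∏ i, M i (s i) (t i)

/-- A density operator: positive semidefinite, of trace one. -/
def IsDensity {n d : ℕ} (ρ : GlobalOp n d) : Prop :=
  ρ.PosSemidef ∧ ρ.trace = 1

/-- A (general) POVM on `ℂ^d` with `v` outcomes. -/
def IsPOVM {d v : ℕ} (E : Fin v → LocalOp d) : Prop :=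
  (∀ a, (E a).PosSemidef) ∧ ∑ a, E a = 1

/-- The set `𝒬_d` of the `(n, m, v)` Bell scenario: the boxes
`p[a | x] = Tr (ρ (A_{a 0 | x 0} ⊗ ⋯ ⊗ A_{a (n-1) | x (n-1)}))`, where `ρ` is any density operator on
`(ℂ^d)^{⊗ n}` and `A i` gives, for every input, any POVM of the party `i` on its own `ℂ^d`. -/
def quantumSet (d n m v : ℕ) : Set (Box n m v) :=
  {p | ∃ (ρ : GlobalOp n d) (A : Fin n → Fin m → Fin v → LocalOp d),
    IsDensity ρ ∧ (∀ i x, IsPOVM (A i x)) ∧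
    ∀ x a, (p x a : ℂ) = (ρ * tensorOp fun i => A i (x i) (a i)).trace}

/-- The sign of an outcome: `+1` for the outcome `1` and `-1` for the outcome `0`. -/
def outcomeSign (a : Fin 2) : ℝ := if a = 1 then 1 else -1

/-- The `(2, 2, 2)` box with the marginal biases `⟨A_x⟩ = α x`, `⟨B_y⟩ = β y` and the joint biases
`⟨A_x B_y⟩ = γ x y`, where `⟨A_x⟩ = p[a=1|x] - p[a=0|x]`, `⟨B_y⟩ = p[b=1|y] - p[b=0|y]` and
`⟨A_x B_y⟩ = p[a=b|xy] - p[a≠b|xy]`. -/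
noncomputable def biasBox (α β : Fin 2 → ℝ) (γ : Fin 2 → Fin 2 → ℝ) : Box 2 2 2 :=
  fun x a => (1 + outcomeSign (a 0) * α (x 0) + outcomeSign (a 1) * β (x 1)
    + outcomeSign (a 0) * outcomeSign (a 1) * γ (x 0) (x 1)) / 4

/-- All four marginal and all four joint biases are `1`: both parties always output `1`. -/
noncomputable def P₁ : Box 2 2 2 := biasBox ![1, 1] ![1, 1] ![![1, 1], ![1, 1]]

/-- Both parties output `1` on the input `0` and `0` on the input `1`. -/
noncomputable def P₃ : Box 2 2 2 := biasBox ![1, -1] ![1, -1] ![![1, -1], ![-1, 1]]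

/-- Both parties output `0` on the input `0` and `1` on the input `1`. -/
noncomputable def P₄ : Box 2 2 2 := biasBox ![-1, 1] ![-1, 1] ![![1, -1], ![-1, 1]]

end Bell

/-!
All the boxes involved are mixtures of deterministic ones. Two deterministic strategies can be mixed
with one shared bit, which qubits carry as the classical state `c |0⋯0⟩⟨0⋯0| + d |1⋯1⟩⟨1⋯1|`, measured
in the computational basis (`smul_detBox_add_smul_detBox_mem`). Hence the deterministic boxes and the
segments between them lie in `𝒬₂`.

Three strategies would need a shared trit. Take the strategies in which every party gives the answer
`0` never, exactly to the input `1`, or exactly to the input `0`. Suppose that a state `ρ` and POVMs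
realize a mixture of them with weights `c₀, c₁, c₂`, and let `E x`, `F y` be the effects of the answer
`0` of the first two parties. On the inputs `0` and `1`, these parties answer equal inputs equally,
and never both answer `0` to different inputs. An event of probability zero has an effect that
annihilates `ρ` (`Matrix.PosSemidef.mul_eq_zero_of_trace_mul_eq_zero`), so `(E x ⊗ 1) ρ = (1 ⊗ F x) ρ`,
`(E x ⊗ F x) ρ = (E x ⊗ 1) ρ`, and `(E 0 ⊗ F 1) ρ = (E 1 ⊗ F 0) ρ = 0`. Moving effects between the two
parties gives `(E x² ⊗ 1) ρ = (E x ⊗ 1) ρ` and `(E 0 E 1 ⊗ 1) ρ = (E 1 E 0 ⊗ 1) ρ = 0`. So the three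
operators `1 - E 0 - E 1`, `E 1`, `E 0` on `ℂ²` are pairwise orthogonal on `ρ`. Three nonzero vectors
in `ℂ²` are not pairwise orthogonal, so one of the operators annihilates `ρ`
(`exists_pairOp_mul_eq_zero`). Its expectation, which is one of the weights, vanishes. The argument
uses only two parties and two inputs, and neither projectivity of the POVMs nor purity of `ρ`.
-/

namespace Bell

open Matrix

/-! ### Tensor products of local operators -/

theorem tensorOp_one {n d : ℕ} : tensorOp (fun _ : Fin n => (1 : LocalOp d)) = 1 := by
  ext s t
  simp only [tensorOp, of_apply, one_apply, Finset.prod_ite_zero, Finset.prod_const_one,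
    Finset.mem_univ, forall_const, funext_iff]

theorem tensorOp_mul {n d : ℕ} (M N : Fin n → LocalOp d) :
    tensorOp M * tensorOp N = tensorOp fun i => M i * N i := by
  ext s t
  simp only [tensorOp, mul_apply, of_apply, ← Finset.prod_mul_distrib, Finset.prod_univ_sum,
    Fintype.piFinset_univ]

theorem tensorOp_conjTranspose {n d : ℕ} (M : Fin n → LocalOp d) :
    (tensorOp M)ᴴ = tensorOp fun i => (M i)ᴴ := by
  ext s t
  simp [tensorOp, conjTranspose_apply]

theorem tensorOp_sum {n d v : ℕ} (M : Fin n → Fin v → LocalOp d) (S : Fin n → Finset (Fin v)) :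
    tensorOp (fun i => ∑ a ∈ S i, M i a)
      = ∑ a ∈ Fintype.piFinset S, tensorOp fun i => M i (a i) := by
  ext s t
  simp only [tensorOp, Matrix.sum_apply, of_apply, Finset.prod_univ_sum]

open scoped MatrixOrder in
theorem _root_.Matrix.PosSemidef.exists_eq_conjTranspose_mul_self {ι : Type*} [Fintype ι]
    [DecidableEq ι] {M : Matrix ι ι ℂ} (hM : M.PosSemidef) : ∃ B : Matrix ι ι ℂ, M = Bᴴ * B :=
  CStarAlgebra.nonneg_iff_eq_star_mul_self.mp hM.nonneg

theorem posSemidef_tensorOp {n d : ℕ} {M : Fin n → LocalOp d} (hM : ∀ i, (M i).PosSemidef) :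
    (tensorOp M).PosSemidef := by
  choose B hB using fun i => (hM i).exists_eq_conjTranspose_mul_self
  have h : tensorOp M = (tensorOp B)ᴴ * tensorOp B := by
    rw [tensorOp_conjTranspose, tensorOp_mul]
    exact congrArg tensorOp (funext hB)
  rw [h]
  exact posSemidef_conjTranspose_mul_self _

/-- An event of probability zero is described by an effect that annihilates the state. -/
theorem _root_.Matrix.PosSemidef.mul_eq_zero_of_trace_mul_eq_zero {ι : Type*} [Fintype ι]
    [DecidableEq ι] {ρ T : Matrix ι ι ℂ} (hρ : ρ.PosSemidef) (hT : T.PosSemidef)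
    (h : (ρ * T).trace = 0) : T * ρ = 0 := by
  obtain ⟨C, rfl⟩ := hρ.exists_eq_conjTranspose_mul_self
  obtain ⟨D, rfl⟩ := hT.exists_eq_conjTranspose_mul_self
  have h0 : D * Cᴴ = 0 := by
    rw [← trace_conjTranspose_mul_self_eq_zero_iff, ← h, conjTranspose_mul,
      conjTranspose_conjTranspose, Matrix.mul_assoc, trace_mul_comm]
    simp only [Matrix.mul_assoc]
    rw [trace_mul_comm]
    simp only [Matrix.mul_assoc]
    rw [trace_mul_comm]
    simp only [Matrix.mul_assoc]
  rw [Matrix.mul_assoc, ← Matrix.mul_assoc D, h0, Matrix.zero_mul, Matrix.mul_zero]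

/-! ### Operators on the first two parties -/

/-- The operator `M ⊗ N ⊗ 1 ⊗ ⋯ ⊗ 1`. -/
def pairOp {k d : ℕ} (M N : LocalOp d) : GlobalOp (k + 2) d :=
  tensorOp (Fin.cons M (Fin.cons N fun _ => 1))

theorem pairOp_one_one {k d : ℕ} : pairOp (k := k) (1 : LocalOp d) 1 = 1 := by
  rw [← tensorOp_one, pairOp]
  congr 1
  funext i
  refine Fin.cases rfl (fun i => ?_) i
  refine Fin.cases rfl (fun i => rfl) i

theorem pairOp_mul {k d : ℕ} (M N M' N' : LocalOp d) :
    pairOp (k := k) M N * pairOp M' N' = pairOp (M * M') (N * N') := by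
  rw [pairOp, pairOp, pairOp, tensorOp_mul]
  congr 1
  funext i
  refine Fin.cases rfl (fun i => ?_) i
  refine Fin.cases rfl (fun i => ?_) i
  exact Matrix.one_mul _

theorem pairOp_sub_left {k d : ℕ} (M M' N : LocalOp d) :
    pairOp (k := k) (M - M') N = pairOp M N - pairOp M' N := by
  ext s t
  simp only [pairOp, tensorOp, of_apply, Fin.prod_univ_succ, Fin.cons_zero, Fin.cons_succ,
    Matrix.sub_apply]
  ring

theorem pairOp_sub_right {k d : ℕ} (M N N' : LocalOp d) :
    pairOp (k := k) M (N - N') = pairOp M N - pairOp M N' := by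
  ext s t
  simp only [pairOp, tensorOp, of_apply, Fin.prod_univ_succ, Fin.cons_zero, Fin.cons_succ,
    Matrix.sub_apply]
  ring

theorem posSemidef_pairOp {k d : ℕ} {M N : LocalOp d} (hM : M.PosSemidef) (hN : N.PosSemidef) :
    (pairOp (k := k) M N).PosSemidef := by
  refine posSemidef_tensorOp fun i => ?_
  refine Fin.cases hM (fun i => ?_) i
  refine Fin.cases hN (fun i => ?_) i
  exact PosSemidef.one

/-- An operator `M` of the first party acts on each slice of each column of `ρ` along the
coordinate of that party. -/
theorem pairOp_one_mul_apply {k d : ℕ} (M : LocalOp d) (ρ : GlobalOp (k + 2) d) (i : Fin d)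
    (s : Fin (k + 1) → Fin d) (t : Fin (k + 2) → Fin d) :
    (pairOp M 1 * ρ : GlobalOp (k + 2) d) (Fin.cons i s : Fin (k + 2) → Fin d) t
      = (M *ᵥ fun j => ρ (Fin.cons j s : Fin (k + 2) → Fin d) t) i := by
  have h1 : ∀ u : Fin (k + 1) → Fin d,
      ∏ r, (Fin.cons 1 fun _ => 1 : Fin (k + 1) → LocalOp d) r (s r) (u r)
        = if s = u then 1 else 0 := by
    intro u
    have h2 : (Fin.cons 1 fun _ => 1 : Fin (k + 1) → LocalOp d) = fun _ => 1 := by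
      funext r
      refine Fin.cases rfl (fun r => rfl) r
    have h3 := congrFun₂ (tensorOp_one (n := k + 1) (d := d)) s u
    rw [h2]
    simpa only [tensorOp, of_apply, one_apply] using h3
  rw [mul_apply, ← (Fin.consEquiv fun _ : Fin (k + 2) => Fin d).sum_comp, Fintype.sum_prod_type]
  simp only [mulVec, dotProduct]
  refine Finset.sum_congr rfl fun j _ => ?_
  rw [Finset.sum_eq_single s]
  · simp only [pairOp, tensorOp, of_apply, Fin.consEquiv_apply]
    rw [Fin.prod_univ_succ]
    simp only [Fin.cons_zero, Fin.cons_succ]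
    rw [h1, if_pos rfl, mul_one]
    rfl
  · intro u _ hu
    simp only [pairOp, tensorOp, of_apply, Fin.consEquiv_apply]
    rw [Fin.prod_univ_succ]
    simp only [Fin.cons_zero, Fin.cons_succ]
    rw [h1, if_neg (Ne.symm hu), mul_zero, zero_mul]
  · simp

/-- A `d`-dimensional party has no room for more than `d` Hermitian operators `X i` that are pairwise
orthogonal on the state, unless one of them annihilates it: otherwise each `X i` has a nonzero vector
`X i *ᵥ v i`, with `v i` a slice of a column of `ρ`, and these vectors are pairwise orthogonal. -/
theorem exists_pairOp_mul_eq_zero {ι : Type*} [Fintype ι] {k d : ℕ} (hd : d < Fintype.card ι)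
    {ρ : GlobalOp (k + 2) d} {X : ι → LocalOp d} (hX : ∀ i, (X i).IsHermitian)
    (h : Pairwise fun i j => pairOp (X i * X j) 1 * ρ = 0) : ∃ i, pairOp (X i) 1 * ρ = 0 := by
  by_contra! hne
  have hv : ∀ i, ∃ (s : Fin (k + 1) → Fin d) (t : Fin (k + 2) → Fin d),
      X i *ᵥ (fun j => ρ (Fin.cons j s : Fin (k + 2) → Fin d) t) ≠ 0 := by
    intro i
    by_contra! h0
    refine hne i ?_
    ext s t
    have h1 := pairOp_one_mul_apply (X i) ρ (s 0) (Fin.tail s) t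
    rw [Fin.cons_self_tail, h0] at h1
    exact h1
  choose s t hst using hv
  set v : ι → Fin d → ℂ := fun i j => ρ (Fin.cons j (s i) : Fin (k + 2) → Fin d) (t i)
  have hli : LinearIndependent ℂ
      (fun i => WithLp.toLp 2 (X i *ᵥ v i) : ι → EuclideanSpace ℂ (Fin d)) := by
    refine linearIndependent_of_ne_zero_of_inner_eq_zero (𝕜 := ℂ) (fun i hi => ?_)
      fun i j hij => ?_
    · exact hst i (by simpa using hi)
    · have h1 : (X i * X j) *ᵥ v j = 0 := by
        funext r
        rw [← pairOp_one_mul_apply, h hij]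
        rfl
      change inner ℂ (WithLp.toLp 2 (X i *ᵥ v i)) (WithLp.toLp 2 (X j *ᵥ v j)) = 0
      rw [EuclideanSpace.inner_eq_star_dotProduct, dotProduct_comm, star_mulVec,
        ← dotProduct_mulVec, (hX i).eq, mulVec_mulVec, h1, dotProduct_zero]
  have := hli.fintype_card_le_finrank
  rw [finrank_euclideanSpace, Fintype.card_fin] at this
  omega

/-! ### Marginals of the first two parties -/

/-- The probability in the box `p`, given the inputs `x` of the first party and `y` of all others,
that the outcome of the first party lies in `S` and that of the second one in `T`. -/
def pairProb {k m v : ℕ} (p : Box (k + 2) m v) (x y : Fin m) (S T : Finset (Fin v)) : ℝ :=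
  ∑ a ∈ Fintype.piFinset (Fin.cons S (Fin.cons T fun _ => Finset.univ)),
    p (Fin.cons x fun _ => y) a

theorem pairProb_eq_trace {k d m v : ℕ} {p : Box (k + 2) m v} {ρ : GlobalOp (k + 2) d}
    {A : Fin (k + 2) → Fin m → Fin v → LocalOp d} (hA : ∀ i x, IsPOVM (A i x))
    (hp : ∀ x a, (p x a : ℂ) = (ρ * tensorOp fun i => A i (x i) (a i)).trace)
    (x y : Fin m) (S T : Finset (Fin v)) :
    (pairProb p x y S T : ℂ)
      = (ρ * pairOp (∑ a ∈ S, A 0 x a) (∑ b ∈ T, A 1 y b)).trace := by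
  simp only [pairProb, Complex.ofReal_sum, hp]
  rw [← trace_sum, ← Finset.mul_sum]
  have h := tensorOp_sum (fun i => A i ((Fin.cons x fun _ => y : Fin (k + 2) → Fin m) i))
    (Fin.cons S (Fin.cons T fun _ => Finset.univ))
  rw [← h, pairOp]
  congr 3
  funext i
  refine Fin.cases rfl (fun i => ?_) i
  refine Fin.cases rfl (fun i => ?_) i
  exact (hA _ _).2

/-! ### Mixtures of deterministic strategies -/

/-- The box in which the party `i` answers the input `x` by `f i x`. -/
def detBox {n m v : ℕ} (f : Fin n → Fin m → Fin v) : Box n m v :=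
  fun x a => if ∀ i, a i = f i (x i) then 1 else 0

theorem pairProb_detBox {k m v : ℕ} (f : Fin (k + 2) → Fin m → Fin v) (x y : Fin m)
    (S T : Finset (Fin v)) :
    pairProb (detBox f) x y S T = if f 0 x ∈ S ∧ f 1 y ∈ T then 1 else 0 := by
  simp only [pairProb, detBox, ← funext_iff]
  rw [Finset.sum_ite_eq']
  simp only [Fintype.mem_piFinset]
  congr 1
  rw [Fin.forall_fin_succ, Fin.forall_fin_succ]
  simp

theorem pairProb_sum_smul {ι : Type*} [Fintype ι] {k m v : ℕ} (c : ι → ℝ)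
    (p : ι → Box (k + 2) m v) (x y : Fin m) (S T : Finset (Fin v)) :
    pairProb (∑ i, c i • p i) x y S T = ∑ i, c i * pairProb (p i) x y S T := by
  simp only [pairProb, Finset.sum_apply, Pi.smul_apply, smul_eq_mul, Finset.mul_sum]
  exact Finset.sum_comm

/-- Mixing two deterministic strategies takes one shared bit, which
`c |0⋯0⟩⟨0⋯0| + d |1⋯1⟩⟨1⋯1|` provides. -/
theorem smul_detBox_add_smul_detBox_mem {n m v : ℕ} (f g : Fin n → Fin m → Fin v)
    {c d : ℝ} (hc : 0 ≤ c) (hd : 0 ≤ d) (hcd : c + d = 1) :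
    c • detBox f + d • detBox g ∈ quantumSet 2 n m v := by
  let w : (Fin n → Fin 2) → ℂ := fun s =>
    (if s = fun _ => 0 then (c : ℂ) else 0) + (if s = fun _ => 1 then (d : ℂ) else 0)
  let A : Fin n → Fin m → Fin v → LocalOp 2 := fun i x a =>
    diagonal ![if a = f i x then 1 else 0, if a = g i x then 1 else 0]
  have hsum : ∀ F : (Fin n → Fin 2) → ℂ,
      ∑ s, w s * F s = c * F (fun _ => 0) + d * F (fun _ => 1) := by
    intro F
    simp [w, add_mul, Finset.sum_add_distrib]
  refine ⟨diagonal w, A, ⟨PosSemidef.diagonal fun s => ?_, ?_⟩,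
    fun i x => ⟨fun a => PosSemidef.diagonal fun s => ?_, ?_⟩, fun x a => ?_⟩
  · exact add_nonneg (by split_ifs <;> simp [hc]) (by split_ifs <;> simp [hd])
  · have := hsum fun _ => 1
    simp only [mul_one] at this
    rw [trace_diagonal, this]
    exact_mod_cast hcd
  · fin_cases s <;> simp <;> split_ifs <;> simp
  · ext s t
    simp only [A, Matrix.sum_apply, diagonal_apply, one_apply]
    fin_cases s <;> fin_cases t <;> simp
  · have htr : (diagonal w * tensorOp fun i => A i (x i) (a i)).trace
        = ∑ s, w s * ∏ i, A i (x i) (a i) (s i) (s i) := by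
      simp only [trace, diag_apply, diagonal_mul, tensorOp, of_apply]
    rw [htr, hsum]
    simp [A, detBox, Finset.prod_ite_zero, apply_ite Complex.ofReal]

/-- A strategy uses the same answers for all parties; these are the answers of the three strategies
mixed in the counterexample. Strategy `1` answers `0` exactly to the input `1`, strategy `2` exactly
to the input `0`, and strategy `0` always answers `1`. -/
def answer {m v : ℕ} : Fin 3 → Fin (m + 2) → Fin (v + 2) :=
  ![fun _ => 1, fun x => if x = 1 then 0 else 1, fun x => if x = 0 then 0 else 1]

/-- A box of `𝒬₂` cannot mix all three of the strategies `answer` with nonzero weights. The effects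
`E 0`, `E 1` of the answer `0` of the first party and the remainder `1 - E 0 - E 1` are pairwise
orthogonal on the state, so one of them annihilates it; their expectations are the weights. -/
theorem exists_eq_zero_of_sum_answer_mem {k m v : ℕ} {c : Fin 3 → ℝ} (hc : ∑ l, c l = 1)
    (hq : ∑ l, c l • detBox (fun _ => answer l) ∈ quantumSet 2 (k + 2) (m + 2) (v + 2)) :
    ∃ l, c l = 0 := by
  obtain ⟨ρ, A, ⟨hρ, htr⟩, hA, hp⟩ := hq
  rw [Fin.sum_univ_three] at hc
  -- The effects of the answer `0` of the first and of the second party.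
  set E : Fin (m + 2) → LocalOp 2 := fun x => A 0 x 0
  set F : Fin (m + 2) → LocalOp 2 := fun y => A 1 y 0
  have hcompl : ∀ i x, ∑ a ∈ ({0}ᶜ : Finset (Fin (v + 2))), A i x a = 1 - A i x 0 := by
    intro i x
    rw [← (hA i x).2, ← Finset.sum_add_sum_compl {0}, Finset.sum_singleton, add_sub_cancel_left]
  have hcpos : ∀ i x, (1 - A i x 0).PosSemidef := fun i x => by
    rw [← hcompl]
    exact posSemidef_sum _ fun a _ => (hA i x).1 a
  have hprob := fun x y S T =>
    (pairProb_eq_trace hA hp x y S T).symm.trans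
      (congrArg Complex.ofReal (pairProb_sum_smul c _ x y S T))
  simp only [pairProb_detBox, Fin.sum_univ_three] at hprob
  -- The events that never occur.
  have hEF' : ∀ x : Fin (m + 2), x = 0 ∨ x = 1 → pairOp (E x) (1 - F x) * ρ = 0 := by
    intro x hx
    refine hρ.mul_eq_zero_of_trace_mul_eq_zero (posSemidef_pairOp ((hA 0 x).1 0) (hcpos 1 x)) ?_
    have h := hprob x x {0} {0}ᶜ
    rw [Finset.sum_singleton, hcompl] at h
    rw [h]
    simp
  have hE'F : ∀ x : Fin (m + 2), x = 0 ∨ x = 1 → pairOp (1 - E x) (F x) * ρ = 0 := by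
    intro x hx
    refine hρ.mul_eq_zero_of_trace_mul_eq_zero (posSemidef_pairOp (hcpos 0 x) ((hA 1 x).1 0)) ?_
    have h := hprob x x {0}ᶜ {0}
    rw [Finset.sum_singleton, hcompl] at h
    rw [h]
    simp
  have hEF01 : pairOp (E 0) (F 1) * ρ = 0 := by
    refine hρ.mul_eq_zero_of_trace_mul_eq_zero (posSemidef_pairOp ((hA 0 0).1 0) ((hA 1 1).1 0)) ?_
    have h := hprob 0 1 {0} {0}
    rw [Finset.sum_singleton, Finset.sum_singleton] at h
    rw [h]
    simp [answer]
  have hEF10 : pairOp (E 1) (F 0) * ρ = 0 := by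
    refine hρ.mul_eq_zero_of_trace_mul_eq_zero (posSemidef_pairOp ((hA 0 1).1 0) ((hA 1 0).1 0)) ?_
    have h := hprob 1 0 {0} {0}
    rw [Finset.sum_singleton, Finset.sum_singleton] at h
    rw [h]
    simp [answer]
  -- On the state, an effect of the first party equals the matching effect of the second one.
  have hL : ∀ x : Fin (m + 2), x = 0 ∨ x = 1 →
      pairOp (E x) 1 * ρ = pairOp 1 (F x) * ρ := by
    intro x hx
    have h1 := hEF' x hx
    have h2 := hE'F x hx
    rw [pairOp_sub_right, Matrix.sub_mul, sub_eq_zero] at h1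
    rw [pairOp_sub_left, Matrix.sub_mul, sub_eq_zero] at h2
    rw [h1, h2]
  have hEE : ∀ x y : Fin (m + 2), y = 0 ∨ y = 1 →
      pairOp (E x * E y) 1 * ρ = pairOp (E x) (F y) * ρ := by
    intro x y hy
    have h1 : pairOp (k := k) (E x * E y) 1 = pairOp (E x) 1 * pairOp (E y) 1 := by
      rw [pairOp_mul, Matrix.one_mul]
    rw [h1, Matrix.mul_assoc, hL y hy, ← Matrix.mul_assoc, pairOp_mul, Matrix.mul_one,
      Matrix.one_mul]
  have hsq : ∀ x : Fin (m + 2), x = 0 ∨ x = 1 →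
      pairOp (E x * E x) 1 * ρ = pairOp (E x) 1 * ρ := by
    intro x hx
    have h1 := hEF' x hx
    rw [pairOp_sub_right, Matrix.sub_mul, sub_eq_zero] at h1
    rw [hEE x x hx, h1]
  have h01 : pairOp (E 0 * E 1) 1 * ρ = 0 := (hEE 0 1 (Or.inr rfl)).trans hEF01
  have h10 : pairOp (E 1 * E 0) 1 * ρ = 0 := (hEE 1 0 (Or.inl rfl)).trans hEF10
  have h00 := hsq 0 (Or.inl rfl)
  have h11 := hsq 1 (Or.inr rfl)
  have hH : ∀ x, (E x).IsHermitian := fun x => ((hA 0 x).1 0).isHermitian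
  -- Three operators that are pairwise orthogonal on the state, in dimension two. The order
  -- matches the weights: `E 1` and `E 0` detect the strategies `1` and `2`.
  obtain ⟨l, hl⟩ : ∃ l, pairOp (![1 - E 0 - E 1, E 1, E 0] l) 1 * ρ = 0 := by
    refine exists_pairOp_mul_eq_zero (by simp) (fun l => ?_) fun l l' hll' => ?_
    · fin_cases l
      · exact (isHermitian_one.sub (hH 0)).sub (hH 1)
      · exact hH 1
      · exact hH 0
    · fin_cases l <;> fin_cases l' <;> first
        | exact absurd rfl hll'
        | simp [Matrix.sub_mul, Matrix.mul_sub, pairOp_sub_left, h00, h01, h10, h11]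
  have htr0 : ∀ x, (ρ * pairOp (E x) 1).trace
      = ((∑ l, c l * if answer l x = (0 : Fin (v + 2)) then 1 else 0 : ℝ) : ℂ) := by
    intro x
    have h := hprob x x {0} Finset.univ
    rw [Finset.sum_singleton, (hA 1 x).2] at h
    rw [h]
    simp [Fin.sum_univ_three]
  have h0 : (ρ * pairOp (E 0) 1).trace = (c 2 : ℂ) := by
    rw [htr0]
    simp [Fin.sum_univ_three, answer]
  have h1 : (ρ * pairOp (E 1) 1).trace = (c 1 : ℂ) := by
    rw [htr0]
    simp [Fin.sum_univ_three, answer]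
  have htrl := congrArg trace hl
  rw [trace_mul_comm, trace_zero] at htrl
  refine ⟨l, ?_⟩
  fin_cases l
  · have h2 : (ρ * pairOp (1 - E 0 - E 1) 1).trace = 0 := htrl
    rw [pairOp_sub_left, pairOp_sub_left, pairOp_one_one, Matrix.mul_sub, Matrix.mul_sub,
      Matrix.mul_one, trace_sub, trace_sub, h0, h1, htr] at h2
    have h3 : (1 : ℝ) - c 2 - c 1 = 0 := by exact_mod_cast h2
    change c 0 = 0
    linarith
  · exact_mod_cast h1.symm.trans htrl
  · exact_mod_cast h0.symm.trans htrl

theorem detBox_mem {n m v : ℕ} (f : Fin n → Fin m → Fin v) : detBox f ∈ quantumSet 2 n m v := by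
  simpa using smul_detBox_add_smul_detBox_mem f f zero_le_one le_rfl (add_zero 1)

theorem not_convex_quantumSet (k m v : ℕ) :
    ¬ Convex ℝ (quantumSet 2 (k + 2) (m + 2) (v + 2)) := by
  intro h
  obtain ⟨l, hl⟩ := exists_eq_zero_of_sum_answer_mem (k := k) (m := m) (v := v)
    (c := fun _ => 1 / 3) (by simp)
    (h.sum_mem (fun _ _ => by norm_num) (by simp) fun l _ => detBox_mem _)
  norm_num at hl

/-! ### The CHSH scenario -/

theorem answer_two {m v : ℕ} :
    answer 2 = fun x : Fin (m + 2) => if x = 0 then (0 : Fin (v + 2)) else 1 := rfl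

theorem P₁_eq_detBox : P₁ = detBox fun _ => answer 0 := by
  funext x a
  simp only [P₁, biasBox, detBox, answer, outcomeSign, Fin.forall_fin_two]
  generalize x 0 = x0, x 1 = x1, a 0 = a0, a 1 = a1
  fin_cases x0 <;> fin_cases x1 <;> fin_cases a0 <;> fin_cases a1 <;> norm_num

theorem P₃_eq_detBox : P₃ = detBox fun _ => answer 1 := by
  funext x a
  simp only [P₃, biasBox, detBox, answer, outcomeSign, Fin.forall_fin_two]
  generalize x 0 = x0, x 1 = x1, a 0 = a0, a 1 = a1
  fin_cases x0 <;> fin_cases x1 <;> fin_cases a0 <;> fin_cases a1 <;> norm_num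

theorem P₄_eq_detBox : P₄ = detBox fun _ => answer 2 := by
  funext x a
  simp only [P₄, biasBox, detBox, answer_two, outcomeSign, Fin.forall_fin_two]
  generalize x 0 = x0, x 1 = x1, a 0 = a0, a 1 = a1
  fin_cases x0 <;> fin_cases x1 <;> fin_cases a0 <;> fin_cases a1 <;> norm_num

end Bell

theorem mainTheorem1 :
    (∀ n m v : ℕ, 2 ≤ n → 2 ≤ m → 2 ≤ v → ¬ Convex ℝ (Bell.quantumSet 2 n m v)) ∧
    (Bell.P₁ ∈ Bell.quantumSet 2 2 2 2 ∧ Bell.P₃ ∈ Bell.quantumSet 2 2 2 2 ∧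
      Bell.P₄ ∈ Bell.quantumSet 2 2 2 2) ∧
    ∀ c₁ c₃ c₄ : ℝ, 0 ≤ c₁ → 0 ≤ c₃ → 0 ≤ c₄ → c₁ + c₃ + c₄ = 1 →
      (c₁ • Bell.P₁ + c₃ • Bell.P₃ + c₄ • Bell.P₄ ∈ Bell.quantumSet 2 2 2 2 ↔
        c₁ = 0 ∨ c₃ = 0 ∨ c₄ = 0) := by
  refine ⟨fun n m v hn hm hv => ?_, ?_, fun c₁ c₃ c₄ h₁ h₃ h₄ hc => ⟨fun h => ?_, fun h => ?_⟩⟩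
  · obtain ⟨k, rfl⟩ := Nat.exists_eq_add_of_le' hn
    obtain ⟨m, rfl⟩ := Nat.exists_eq_add_of_le' hm
    obtain ⟨v, rfl⟩ := Nat.exists_eq_add_of_le' hv
    exact Bell.not_convex_quantumSet k m v
  · rw [Bell.P₁_eq_detBox, Bell.P₃_eq_detBox, Bell.P₄_eq_detBox]
    exact ⟨Bell.detBox_mem _, Bell.detBox_mem _, Bell.detBox_mem _⟩
  · rw [Bell.P₁_eq_detBox, Bell.P₃_eq_detBox, Bell.P₄_eq_detBox] at h
    obtain ⟨l, hl⟩ := Bell.exists_eq_zero_of_sum_answer_mem (k := 0) (m := 0) (v := 0)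
      (c := ![c₁, c₃, c₄]) (by simpa [Fin.sum_univ_three] using hc)
      (by simpa [Fin.sum_univ_three] using h)
    fin_cases l
    · exact Or.inl hl
    · exact Or.inr (Or.inl hl)
    · exact Or.inr (Or.inr hl)
  · rw [Bell.P₁_eq_detBox, Bell.P₃_eq_detBox, Bell.P₄_eq_detBox]
    rcases h with rfl | rfl | rfl
    · rw [zero_smul, zero_add]
      exact Bell.smul_detBox_add_smul_detBox_mem _ _ h₃ h₄ (by linarith)
    · rw [zero_smul, add_zero]
      exact Bell.smul_detBox_add_smul_detBox_mem _ _ h₁ h₄ (by linarith)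
    · rw [zero_smul, add_zero]
      exact Bell.smul_detBox_add_smul_detBox_mem _ _ h₁ h₃ (by linarith)
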